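/- Let $w=(w_n)_{n\in\mathbb Z}$ be a sequence of positive real numbers, and let $X$ be the complex Banach space $\ell_p(\mathbb Z)$ with $1\le p<\infty$, or $c_0(\mathbb Z)$ with the supremum norm. Suppose that the bilateral weighted shift $B_w(x_n)_{n\in\mathbb Z}=(w_{n+1}x_{n+1})_{n\in\mathbb Z}$ defines an invertible bounded linear operator on $X$. Then $B_w$ is strongly structurally stable if and only if $B_w$ has the shadowing property. Here a bounded linear operator $T$ on a complex Banach space $X$ is strongly structurally stable if for every $\varepsilon>0$ there is $\delta>0$ such that, for every Lipschitz map $\alpha:X\to X$ with $\sup_{x}\|\alpha(x)\|\le\delta$ and Lipschitz constant at most $\delta$, there is a map $\varphi:X\to X$ with $\sup_x\|\varphi(x)\|\le\varepsilon$ such that $I+\varphi$ is a homeomorphism of $X$ onto $X$ and $T\circ(I+\varphi)=(I+\varphi)\circ(T+\alpha)$. An invertible bounded linear operator $T$ on $X$ has the shadowing property if for every $\varepsilon>0$ there is $\delta>0$ such that, for every sequence $(x_n)_{n\in\mathbb Z}$ in $X$ with $\|Tx_n-x_{n+1}\|\le\delta$ for all $n\in\mathbb Z$, there is $x\in X$ with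 $\|T^nx-x_n\|<\varepsilon$ for all $n\in\mathbb Z$. -/

import Mathlib

open scoped ENNReal

/-- The formal bilateral weighted backward shift `B_w (x_n) = (w_{n+1} x_{n+1})` on all complex
sequences indexed by `ℤ`. -/
def bilateralShift (w : ℤ → ℝ) (x : ℤ → ℂ) : ℤ → ℂ :=
  fun n => (w (n + 1) : ℂ) * x (n + 1)

section Dynamics

variable {X : Type*} [NormedAddCommGroup X] [NormedSpace ℂ X]

/-- Strong structural stability: every perturbation `T + α` of `T`, with `α` Lipschitz, uniformly
small and of small Lipschitz constant, is conjugate to `T` by a homeomorphism `I + φ` of `X` that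
is uniformly close to the identity. -/
def StronglyStructurallyStable (T : X →L[ℂ] X) : Prop :=
  ∀ ε : ℝ, 0 < ε → ∃ δ : ℝ, 0 < δ ∧
    ∀ α : X → X, (∀ x, ‖α x‖ ≤ δ) → (∀ x y, ‖α x - α y‖ ≤ δ * ‖x - y‖) →
      ∃ φ : X → X, (∀ x, ‖φ x‖ ≤ ε) ∧ IsHomeomorph (fun x => x + φ x) ∧
        ∀ x, T (x + φ x) = (T x + α x) + φ (T x + α x)

/-- `(x_n)_{n ∈ ℤ}` is a `δ`-pseudotrajectory of `T`. -/
def IsPseudotrajectory (T : X →L[ℂ] X) (δ : ℝ) (x : ℤ → X) : Prop :=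
  ∀ n : ℤ, ‖T (x n) - x (n + 1)‖ ≤ δ

/-- The shadowing property of an invertible operator; `T ^ n`, `n ∈ ℤ`, is the power in the group
of invertible bounded operators. -/
def HasShadowing (T : X ≃L[ℂ] X) : Prop :=
  ∀ ε : ℝ, 0 < ε → ∃ δ : ℝ, 0 < δ ∧
    ∀ x : ℤ → X, IsPseudotrajectory (T : X →L[ℂ] X) δ x →
      ∃ y : X, ∀ n : ℤ, ‖(T ^ n) y - x n‖ < ε

end Dynamics

/-! ### Summable Green kernels, shadowing and structural stability. -/

section Green

variable {X : Type*} [NormedAddCommGroup X] [NormedSpace ℂ X]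

/-- A summable operator-valued kernel on `ℤ` which inverts, by convolution, the difference operator
`(y_n) ↦ (y_{n+1} - T y_n)` on bounded sequences. -/
structure IsGreenKernel (T : X →L[ℂ] X) (Γ : ℤ → X →L[ℂ] X) : Prop where
  summable : Summable fun n => ‖Γ n‖
  recurrence : ∀ n x, Γ (n - 1) x = T (Γ n x) + if n = 0 then x else 0

/-- The value at time `0` of the convolution of a kernel with a sequence. -/
noncomputable def greenSum (Γ : ℤ → X →L[ℂ] X) (c : ℤ → X) : X := ∑' n, Γ n (c n)

theorem norm_kernel_apply_le (Γ : ℤ → X →L[ℂ] X) {c : ℤ → X} {M : ℝ} (hc : ∀ n, ‖c n‖ ≤ M)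
    (n : ℤ) : ‖Γ n (c n)‖ ≤ ‖Γ n‖ * M :=
  (Γ n).le_of_opNorm_le_of_le le_rfl (hc n)

theorem norm_greenSum_le {Γ : ℤ → X →L[ℂ] X} (hΓ : Summable fun n => ‖Γ n‖) {c : ℤ → X} {M : ℝ}
    (hc : ∀ n, ‖c n‖ ≤ M) : ‖greenSum Γ c‖ ≤ (∑' n, ‖Γ n‖) * M :=
  tsum_of_norm_bounded (hΓ.hasSum.mul_right M) (norm_kernel_apply_le Γ hc)

theorem ContinuousLinearEquiv.eq_zpow_apply_of_orbit (T : X ≃L[ℂ] X) {o : ℤ → X}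
    (ho : ∀ n, o (n + 1) = T (o n)) (n : ℤ) : o n = (T ^ n) (o 0) := by
  have step : ∀ n : ℤ, (T ^ (n + 1)) (o 0) = T ((T ^ n) (o 0)) := fun n => by
    rw [add_comm, zpow_one_add]; rfl
  induction n using Int.induction_on with
  | zero => rfl
  | succ k ih => rw [ho, step, ih]
  | pred k ih =>
    apply T.injective
    rw [← ho, ← step, sub_add_cancel, ih]

theorem Homeomorph.eq_zpow_apply_of_orbit {Y : Type*} [TopologicalSpace Y] (S : Y ≃ₜ Y)
    {o : ℤ → Y} (ho : ∀ n, o (n + 1) = S (o n)) (n : ℤ) : o n = (S ^ n) (o 0) := by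
  have step : ∀ n : ℤ, (S ^ (n + 1)) (o 0) = S ((S ^ n) (o 0)) := fun n => by
    rw [add_comm, zpow_one_add]; rfl
  induction n using Int.induction_on with
  | zero => rfl
  | succ k ih => rw [ho, step, ih]
  | pred k ih =>
    apply S.injective
    rw [← ho, ← step, sub_add_cancel, ih]

variable [CompleteSpace X]

theorem summable_kernel_apply {Γ : ℤ → X →L[ℂ] X} (hΓ : Summable fun n => ‖Γ n‖) {c : ℤ → X}
    {M : ℝ} (hc : ∀ n, ‖c n‖ ≤ M) : Summable fun n => Γ n (c n) :=
  Summable.of_norm_bounded (hΓ.mul_right M) (norm_kernel_apply_le Γ hc)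

theorem greenSum_sub {Γ : ℤ → X →L[ℂ] X} (hΓ : Summable fun n => ‖Γ n‖) {c d : ℤ → X} {M : ℝ}
    (hc : ∀ n, ‖c n‖ ≤ M) (hd : ∀ n, ‖d n‖ ≤ M) :
    greenSum Γ c - greenSum Γ d = greenSum Γ (fun n => c n - d n) := by
  simp only [greenSum, map_sub]
  exact ((summable_kernel_apply hΓ hc).tsum_sub (summable_kernel_apply hΓ hd)).symm

theorem continuous_greenSum {Γ : ℤ → X →L[ℂ] X} (hΓ : Summable fun n => ‖Γ n‖)
    {Y : Type*} [TopologicalSpace Y] {c : Y → ℤ → X} {M : ℝ} (hc : ∀ y n, ‖c y n‖ ≤ M)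
    (hcont : ∀ n, Continuous fun y => c y n) : Continuous fun y => greenSum Γ (c y) :=
  continuous_tsum (fun n => (Γ n).continuous.comp (hcont n)) (hΓ.mul_right M)
    fun n y => norm_kernel_apply_le Γ (hc y) n

/-- Applied to all translates of `c`, this says that `y_m = ∑ Γ_n c_{n+m}` is a bounded solution of
`y_{m+1} = T y_m + c_m`. -/
theorem IsGreenKernel.greenSum_shift {T : X →L[ℂ] X} {Γ : ℤ → X →L[ℂ] X} (hΓ : IsGreenKernel T Γ)
    {c : ℤ → X} {M : ℝ} (hc : ∀ n, ‖c n‖ ≤ M) :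
    greenSum Γ (fun n => c (n + 1)) = T (greenSum Γ c) + c 0 := by
  have hs := summable_kernel_apply hΓ.summable hc
  have h1 : greenSum Γ (fun n => c (n + 1)) = ∑' n, Γ (n - 1) (c n) := by
    rw [← (Equiv.addRight (1 : ℤ)).tsum_eq fun n => Γ (n - 1) (c n)]
    simp [greenSum]
  rw [h1]
  simp only [hΓ.recurrence]
  rw [Summable.tsum_add, greenSum, ContinuousLinearMap.map_tsum _ hs, tsum_ite_eq]
  · exact T.summable hs
  · exact (hasSum_ite_eq 0 (c 0)).summable.congr fun n => by split_ifs with h <;> simp [h]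

/-- Convolving the errors of a pseudotrajectory with the kernel gives a small sequence with the same
errors; subtracting it leaves a true orbit. -/
theorem IsGreenKernel.hasShadowing {T : X ≃L[ℂ] X} {Γ : ℤ → X →L[ℂ] X}
    (hΓ : IsGreenKernel (T : X →L[ℂ] X) Γ) : HasShadowing T := by
  intro ε hε
  have hL : 0 ≤ ∑' n, ‖Γ n‖ := tsum_nonneg fun _ => norm_nonneg _
  -- The extra 1 makes the final bound strict.
  refine ⟨ε / (∑' n, ‖Γ n‖ + 1), by positivity, fun x hx => ?_⟩
  set δ := ε / (∑' n, ‖Γ n‖ + 1) with hδ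
  have hδ0 : 0 < δ := by positivity
  have hc : ∀ n, ‖x (n + 1) - T (x n)‖ ≤ δ := fun n => by
    rw [norm_sub_rev]; exact hx n
  let y : ℤ → X := fun m => greenSum Γ fun n => x (n + m + 1) - T (x (n + m))
  have hy : ∀ m, y (m + 1) = T (y m) + (x (m + 1) - T (x m)) := fun m => by
    have := hΓ.greenSum_shift (c := fun n => x (n + m + 1) - T (x (n + m))) fun n => hc (n + m)
    simp only [zero_add] at this
    rw [ContinuousLinearEquiv.coe_coe] at this
    rw [← this]
    simp only [y]
    congr 1
    funext n
    rw [show n + 1 + m = n + (m + 1) by ring]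
  have ho : ∀ n, x (n + 1) - y (n + 1) = T (x n - y n) := fun n => by
    rw [hy, map_sub]; abel
  refine ⟨x 0 - y 0, fun n => ?_⟩
  rw [← T.eq_zpow_apply_of_orbit (o := fun n => x n - y n) ho n, sub_sub_cancel_left, norm_neg]
  calc ‖y n‖ ≤ (∑' n, ‖Γ n‖) * δ := norm_greenSum_le hΓ.summable fun k => hc (k + n)
    _ < (∑' n, ‖Γ n‖ + 1) * δ := by gcongr; linarith
    _ = ε := by rw [hδ]; field_simp

/-- A perturbation of an invertible operator with small Lipschitz constant is a homeomorphism. -/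
theorem exists_homeomorph_add (T : X ≃L[ℂ] X) {α : X → X} {δ : ℝ} (hδ : 0 ≤ δ)
    (hδT : δ * ‖(T.symm : X →L[ℂ] X)‖ < 1) (hα : ∀ x y, ‖α x - α y‖ ≤ δ * ‖x - y‖) :
    ∃ S : X ≃ₜ X, ∀ x, S x = T x + α x := by
  lift δ to NNReal using hδ
  have happ : ApproximatesLinearOn (fun x => T x + α x) (T : X →L[ℂ] X) Set.univ δ := by
    intro x _ y _
    convert hα x y using 2
    simp only [ContinuousLinearEquiv.coe_coe, map_sub]
    abel
  refine ⟨happ.toHomeomorph _ ?_, fun x => rfl⟩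
  rcases T.subsingleton_or_nnnorm_symm_pos with h | h
  · exact Or.inl h
  · refine Or.inr ?_
    rw [← one_div, lt_div_iff₀ h]
    exact_mod_cast hδT

theorem dist_greenSum_comp_le {Γ : ℤ → X →L[ℂ] X} (hΓ : Summable fun n => ‖Γ n‖) {α : X → X}
    {δ : ℝ} (hδ : 0 ≤ δ) (hb : ∀ x, ‖α x‖ ≤ δ) (hα : ∀ x y, ‖α x - α y‖ ≤ δ * ‖x - y‖)
    {c d : ℤ → X} {M : ℝ} (hcd : ∀ n, ‖c n - d n‖ ≤ M) :
    ‖greenSum Γ (fun n => α (c n)) - greenSum Γ (fun n => α (d n))‖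
      ≤ (∑' n, ‖Γ n‖) * (δ * M) := by
  rw [greenSum_sub hΓ (fun n => hb (c n)) fun n => hb (d n)]
  exact norm_greenSum_le hΓ fun n => (hα _ _).trans (by gcongr; exact hcd n)

/-- The fixed point equation satisfied by the inverse conjugacy. -/
theorem exists_greenSum_fixedPoint (T : X ≃L[ℂ] X) {Γ : ℤ → X →L[ℂ] X}
    (hΓ : Summable fun n => ‖Γ n‖) {α : X → X} {δ : ℝ} (hδ : 0 ≤ δ)
    (hL : (∑' n, ‖Γ n‖) * δ ≤ 1 / 2) (hb : ∀ x, ‖α x‖ ≤ δ)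
    (hα : ∀ x y, ‖α x - α y‖ ≤ δ * ‖x - y‖) (hcont : Continuous α) :
    ∃ ψ : X → X, Continuous ψ ∧
      ∀ x, ψ x = greenSum Γ fun n => α ((T ^ n) x + ψ ((T ^ n) x)) := by
  let Φ : BoundedContinuousFunction X X → BoundedContinuousFunction X X := fun ψ =>
    BoundedContinuousFunction.ofNormedAddCommGroup
      (fun x => greenSum Γ fun n => α ((T ^ n) x + ψ ((T ^ n) x)))
      (continuous_greenSum hΓ (fun x n => hb _) fun n => by
        have := (T ^ n).continuous
        fun_prop)
      ((∑' n, ‖Γ n‖) * δ) fun x => norm_greenSum_le hΓ fun n => hb _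
  have hΦ : ContractingWith (1 / 2) Φ := by
    refine ⟨by rw [← NNReal.coe_lt_coe]; norm_num, LipschitzWith.of_dist_le_mul fun ψ₁ ψ₂ => ?_⟩
    rw [BoundedContinuousFunction.dist_le (by positivity)]
    intro x
    rw [dist_eq_norm]
    calc _ ≤ (∑' n, ‖Γ n‖) * (δ * dist ψ₁ ψ₂) :=
          dist_greenSum_comp_le hΓ hδ hb hα fun n => by
            rw [add_sub_add_left_eq_sub, ← dist_eq_norm]
            exact BoundedContinuousFunction.dist_coe_le_dist _
      _ = (∑' n, ‖Γ n‖) * δ * dist ψ₁ ψ₂ := by ring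
      _ ≤ 1 / 2 * dist ψ₁ ψ₂ := by gcongr
      _ = _ := by norm_num
  refine ⟨hΦ.fixedPoint, (hΦ.fixedPoint).continuous, fun x => ?_⟩
  conv_lhs => rw [← hΦ.fixedPoint_isFixedPt]
  rfl

/-- Bounded solutions of `y_{n+1} = T y_n` need not vanish, so conjugacies near the identity need
not be unique. The two semiconjugacies `H` and `K` are therefore both defined by Green sums, and the
sums themselves show that they are mutually inverse. -/
theorem IsGreenKernel.stronglyStructurallyStable {T : X ≃L[ℂ] X} {Γ : ℤ → X →L[ℂ] X}
    (hΓ : IsGreenKernel (T : X →L[ℂ] X) Γ) : StronglyStructurallyStable (T : X →L[ℂ] X) := by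
  intro ε hε
  set L := ∑' n, ‖Γ n‖ with hLdef
  set N := ‖(T.symm : X →L[ℂ] X)‖ with hN
  have hL0 : 0 ≤ L := tsum_nonneg fun _ => norm_nonneg _
  have hN0 : 0 ≤ N := norm_nonneg _
  obtain ⟨δ, hδ, hLε, hL, hδN⟩ : ∃ δ > 0, L * δ ≤ ε ∧ L * δ ≤ 1 / 2 ∧ δ * N < 1 := by
    have hm : 0 < min ε 1 := lt_min hε one_pos
    have hm1 : min ε 1 ≤ 1 := min_le_right _ _
    have hmε : min ε 1 ≤ ε := min_le_left _ _
    have hD : 0 < 2 * (L + N + 1) := by positivity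
    refine ⟨min ε 1 / (2 * (L + N + 1)), by positivity, ?_, ?_, ?_⟩
    · rw [mul_div_assoc', div_le_iff₀ hD]; nlinarith
    · rw [mul_div_assoc', div_le_iff₀ hD]; nlinarith
    · rw [div_mul_eq_mul_div, div_lt_iff₀ hD]; nlinarith
  refine ⟨δ, hδ, fun α hb hα => ?_⟩
  have hcont : Continuous α :=
    (LipschitzWith.of_dist_le_mul (K := δ.toNNReal) fun x y => by
      simpa only [dist_eq_norm, Real.coe_toNNReal _ hδ.le] using hα x y).continuous
  obtain ⟨S, hS⟩ := exists_homeomorph_add T hδ.le hδN hα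
  obtain ⟨ψ, hψc, hψ⟩ := exists_greenSum_fixedPoint T hΓ.summable hδ.le hL hb hα hcont
  let φ : X → X := fun x => -greenSum Γ fun n => α ((S ^ n) x)
  let H : X → X := fun x => x + φ x
  let K : X → X := fun x => x + ψ x
  have hφc : Continuous φ := (continuous_greenSum hΓ.summable (fun x n => hb _) fun n =>
    hcont.comp (S ^ n).continuous).neg
  have hTz : ∀ (n : ℤ) x, (T ^ n) (T x) = (T ^ (n + 1)) x := fun n x => by
    rw [zpow_add_one]; rfl
  have hSz : ∀ (n : ℤ) x, (S ^ n) (S x) = (S ^ (n + 1)) x := fun n x => by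
    rw [zpow_add_one]; rfl
  have hTz' : ∀ (n : ℤ) x, T ((T ^ n) x) = (T ^ (n + 1)) x := fun n x => by
    rw [add_comm, zpow_one_add]; rfl
  have hSz' : ∀ (n : ℤ) x, S ((S ^ n) x) = (S ^ (n + 1)) x := fun n x => by
    rw [add_comm, zpow_one_add]; rfl
  have hφS : ∀ x, φ (S x) = T (φ x) - α x := fun x => by
    have := hΓ.greenSum_shift (c := fun n => α ((S ^ n) x)) fun n => hb _
    simp only [φ, hSz, this, map_neg]
    rw [zpow_zero, ContinuousLinearEquiv.coe_coe, neg_add, sub_eq_add_neg]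
    rfl
  have hψT : ∀ x, ψ (T x) = T (ψ x) + α (K x) := fun x => by
    have := hΓ.greenSum_shift (c := fun n => α (K ((T ^ n) x))) fun n => hb _
    rw [hψ, hψ x]
    simp only [hTz]
    refine this.trans ?_
    rw [zpow_zero]
    rfl
  have hHS : ∀ x, H (S x) = T (H x) := fun x => by
    simp only [H, hφS, map_add]; rw [hS]; abel
  have hKT : ∀ x, K (T x) = S (K x) := fun x => by
    rw [hS]; simp only [K, hψT, map_add]; abel
  have hKTn : ∀ (n : ℤ) x, K ((T ^ n) x) = (S ^ n) (K x) := fun n x =>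
    S.eq_zpow_apply_of_orbit (o := fun n => K ((T ^ n) x)) (fun n => by rw [← hTz', hKT]) n
  have hHSn : ∀ (n : ℤ) x, H ((S ^ n) x) = (T ^ n) (H x) := fun n x =>
    T.eq_zpow_apply_of_orbit (o := fun n => H ((S ^ n) x)) (fun n => by rw [← hSz', hHS]) n
  have hHK : ∀ x, H (K x) = x := fun x => by
    have : φ (K x) = -ψ x := by
      rw [hψ x]
      simp only [φ, ← hKTn]
      rfl
    simp only [H, this]
    simp only [K]
    abel
  have hψH : ∀ x, ψ (H x) = greenSum Γ fun n => α (K (H ((S ^ n) x))) := fun x => by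
    rw [hψ]
    simp only [hHSn]
    rfl
  have hKHx : ∀ x, K (H x) - x = ψ (H x) - -φ x := fun x => by
    simp only [K, H]; abel
  -- `K ∘ H - I` is a Green sum of differences of `α` at `K (H (S ^ n x))` and `S ^ n x`, so any
  -- uniform bound on it can be halved.
  have hstep : ∀ M, (∀ x, ‖K (H x) - x‖ ≤ M) → ∀ x, ‖K (H x) - x‖ ≤ M / 2 := fun M hM x => by
    rw [hKHx, hψH, neg_neg]
    calc _ ≤ L * (δ * M) := dist_greenSum_comp_le hΓ.summable hδ.le hb hα fun n => hM _
      _ = L * δ * M := by ring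
      _ ≤ 1 / 2 * M := by
        have : 0 ≤ M := (norm_nonneg _).trans (hM x)
        gcongr
      _ = M / 2 := by ring
  have hgeom : ∀ k : ℕ, ∀ x, ‖K (H x) - x‖ ≤ 2 * (L * δ) / 2 ^ k := fun k => by
    induction k with
    | zero =>
      intro x
      rw [hKHx, neg_neg, hψH]
      refine (norm_sub_le _ _).trans ?_
      have h1 := norm_greenSum_le hΓ.summable (c := fun n => α (K (H ((S ^ n) x)))) fun n => hb _
      have h2 := norm_greenSum_le hΓ.summable (c := fun n => α ((S ^ n) x)) fun n => hb _
      linarith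
    | succ k ih =>
      intro x
      refine (hstep _ ih x).trans (le_of_eq ?_)
      rw [pow_succ, div_div]
  have hKH : ∀ x, K (H x) = x := fun x => by
    have hlim : Filter.Tendsto (fun k : ℕ => 2 * (L * δ) / 2 ^ k) Filter.atTop (nhds 0) :=
      tendsto_const_nhds.div_atTop (tendsto_pow_atTop_atTop_of_one_lt one_lt_two)
    have := ge_of_tendsto' hlim fun k => hgeom k x
    exact sub_eq_zero.1 (norm_le_zero_iff.1 this)
  refine ⟨φ, fun x => ?_, ?_, fun x => ?_⟩
  · rw [norm_neg]
    exact (norm_greenSum_le hΓ.summable fun n => hb _).trans hLε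
  · exact Homeomorph.isHomeomorph
      { toFun := H, invFun := K, left_inv := hKH, right_inv := hHK,
        continuous_toFun := by fun_prop, continuous_invFun := by fun_prop }
  · have := hHS x
    simp only [H, hS] at this
    exact this.symm

end Green

/-! ### Scalar estimates for the weights. -/

section Scalar

theorem exists_forall_succ_eq_add (f : ℤ → ℝ) : ∃ F : ℤ → ℝ, ∀ n, F (n + 1) = F n + f n := by
  let F : ℤ → ℝ := fun n => match n with
    | Int.ofNat k => ∑ i ∈ Finset.range k, f i
    | Int.negSucc k => -∑ i ∈ Finset.range (k + 1), f (-(i : ℤ) - 1)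
  refine ⟨F, fun n => ?_⟩
  rcases n with k | k
  · exact Finset.sum_range_succ _ _
  · rcases k with _ | k
    · have h : Int.negSucc 0 + 1 = Int.ofNat 0 := rfl
      have h0 : F (Int.negSucc 0) = -∑ i ∈ Finset.range (0 + 1), f (-(i : ℤ) - 1) := rfl
      rw [h, h0]
      simp [F]
    · have h : Int.negSucc (k + 1) + 1 = Int.negSucc k := by omega
      have h' : Int.negSucc (k + 1) = -((k + 1 : ℕ) : ℤ) - 1 := by omega
      rw [h]
      simp only [F]
      rw [Finset.sum_range_succ _ (k + 1), ← h']
      ring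

/-- Multiplying the `j`-th coordinate by `v j` turns the weighted shift into the unweighted one. -/
theorem exists_pos_forall_succ_eq_mul {w : ℤ → ℝ} (hw : ∀ n, 0 < w n) :
    ∃ v : ℤ → ℝ, (∀ n, 0 < v n) ∧ ∀ n, v (n + 1) = w (n + 1) * v n := by
  obtain ⟨F, hF⟩ := exists_forall_succ_eq_add fun n => Real.log (w (n + 1))
  refine ⟨fun n => Real.exp (F n), fun n => Real.exp_pos _, fun n => ?_⟩
  simp only [hF, Real.exp_add, Real.exp_log (hw _)]
  ring

variable {v U s : ℤ → ℝ} {K : ℝ}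

/-- The intervals of centre `U i` and radius `K * v i` meet pairwise, so they have a common point,
the supremum of their left ends. -/
theorem exists_sub_const_abs_le (hK : ∀ i j, U i - U j ≤ K * (v i + v j)) :
    ∃ a, ∀ j, |U j - a| ≤ K * v j := by
  have hb : BddAbove (Set.range fun i => U i - K * v i) :=
    ⟨U 0 + K * v 0, by rintro _ ⟨i, rfl⟩; have := hK i 0; linarith⟩
  refine ⟨⨆ i, (U i - K * v i), fun j => abs_le.2 ⟨?_, ?_⟩⟩
  · have : ⨆ i, (U i - K * v i) ≤ U j + K * v j :=
      ciSup_le fun i => by have := hK i j; linarith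
    linarith
  · have := le_ciSup hb j
    linarith

/-- The one-step rate comes from `s (i+1) ≤ s i ≤ K * v i` and `v i = s i - s (i+1)`, whatever the
signs. -/
theorem le_pow_mul_sub (hK : 0 < K) (hs : ∀ j, s j = s (j + 1) + v j)
    (hv : ∀ j, 0 < v j) (hsv : ∀ j, |s j| ≤ K * v j) (j : ℤ) (m : ℕ) :
    s j ≤ (K / (K + 1)) ^ m * s (j - m) := by
  induction m with
  | zero => simp
  | succ m ih =>
    refine ih.trans ?_
    rw [pow_succ, mul_assoc]
    gcongr
    have h1 := hs (j - m - 1)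
    have h2 := (abs_le.1 (hsv (j - m - 1))).2
    have h3 := hv (j - m - 1)
    rw [sub_add_cancel] at h1
    rw [Nat.cast_succ, ← sub_sub, div_mul_eq_mul_div, le_div_iff₀ (by linarith)]
    nlinarith

theorem neg_le_pow_mul_add (hK : 0 < K) (hs : ∀ j, s j = s (j + 1) + v j)
    (hsv : ∀ j, |s j| ≤ K * v j) (j : ℤ) (m : ℕ) :
    -s j ≤ (K / (K + 1)) ^ m * -s (j + m) := by
  induction m with
  | zero => simp
  | succ m ih =>
    refine ih.trans ?_
    rw [pow_succ, mul_assoc]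
    gcongr
    have h1 := hs (j + m)
    have h2 := (abs_le.1 (hsv (j + m))).1
    rw [Nat.cast_succ, ← add_assoc, div_mul_eq_mul_div, le_div_iff₀ (by linarith)]
    nlinarith

/-- The sign condition gives `v j = s j - s (j+1) ≤ 2 * s j`, and `s` decays geometrically. Thus `T
^ m e_j` decays; the companion lemma treats backward iterates. -/
theorem weight_le_pow_mul_sub (hK : 0 < K) (hs : ∀ j, s j = s (j + 1) + v j)
    (hv : ∀ j, 0 < v j) (hsv : ∀ j, |s j| ≤ K * v j) {j : ℤ} (hj : 0 ≤ s j + s (j + 1)) (m : ℕ) :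
    v j ≤ 2 * K * (K / (K + 1)) ^ m * v (j - m) := by
  have h1 := le_pow_mul_sub hK hs hv hsv j m
  have h2 := (abs_le.1 (hsv (j - m))).2
  have h3 : (K / (K + 1)) ^ m * s (j - m) ≤ (K / (K + 1)) ^ m * (K * v (j - m)) := by gcongr
  have h4 := hs j
  nlinarith

theorem weight_le_pow_mul_add (hK : 0 < K) (hs : ∀ j, s j = s (j + 1) + v j)
    (hsv : ∀ j, |s j| ≤ K * v j) {j : ℤ} (hj : s j + s (j + 1) < 0) (m : ℕ) :
    v j ≤ 2 * K * (K / (K + 1)) ^ m * v (j + 1 + m) := by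
  have h1 := neg_le_pow_mul_add hK hs hsv (j + 1) m
  have h2 := neg_le_of_abs_le (hsv (j + 1 + m))
  have h3 : (K / (K + 1)) ^ m * -s (j + 1 + m) ≤ (K / (K + 1)) ^ m * (K * v (j + 1 + m)) := by
    gcongr; linarith
  have h4 := hs j
  nlinarith

end Scalar

/-! ### A bounded Lipschitz perturbation. -/

section RadialRetraction

variable {X : Type*} [NormedAddCommGroup X] [NormedSpace ℂ X]

/-- The radial retraction of a normed space onto its closed unit ball. -/
noncomputable def radialRetraction (x : X) : X := (((max 1 ‖x‖)⁻¹ : ℝ) : ℂ) • x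

theorem norm_radialRetraction_le (x : X) : ‖radialRetraction x‖ ≤ 1 := by
  have h : 0 < max 1 ‖x‖ := by positivity
  rw [radialRetraction, norm_smul, Complex.norm_real, Real.norm_of_nonneg (by positivity),
    inv_mul_le_iff₀ h, mul_one]
  exact le_max_right _ _

theorem norm_radialRetraction_sub_le (x y : X) :
    ‖radialRetraction x - radialRetraction y‖ ≤ 2 * ‖x - y‖ := by
  have hx1 : 1 ≤ max 1 ‖x‖ := le_max_left _ _
  have hx : 0 < max 1 ‖x‖ := by positivity
  have hy : 0 < max 1 ‖y‖ := by positivity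
  have hxy : |max 1 ‖y‖ - max 1 ‖x‖| ≤ ‖x - y‖ := by
    rw [norm_sub_rev]
    simpa only [max_comm] using
      (abs_max_sub_max_le_abs ‖y‖ ‖x‖ 1).trans (abs_norm_sub_norm_le y x)
  have key : radialRetraction x - radialRetraction y =
      (((max 1 ‖x‖)⁻¹ : ℝ) : ℂ) • ((x - y) +
        ((max 1 ‖y‖ - max 1 ‖x‖ : ℝ) : ℂ) • radialRetraction y) := by
    have hyc : ((max 1 ‖y‖ : ℝ) : ℂ) ≠ 0 := by exact_mod_cast hy.ne'
    have hxc : ((max 1 ‖x‖ : ℝ) : ℂ) ≠ 0 := by exact_mod_cast hx.ne'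
    simp only [radialRetraction]
    match_scalars
    · ring
    · field_simp
      ring
  rw [key, norm_smul, Complex.norm_real, Real.norm_of_nonneg (by positivity)]
  have h2 : ‖(x - y) + ((max 1 ‖y‖ - max 1 ‖x‖ : ℝ) : ℂ) • radialRetraction y‖
      ≤ 2 * ‖x - y‖ := by
    refine (norm_add_le _ _).trans ?_
    rw [norm_smul, Complex.norm_real, Real.norm_eq_abs]
    have := mul_le_mul hxy (norm_radialRetraction_le y) (norm_nonneg _) (norm_nonneg _)
    linarith
  calc _ ≤ 1 * (2 * ‖x - y‖) :=
        mul_le_mul (inv_le_one_of_one_le₀ hx1) h2 (norm_nonneg _) zero_le_one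
    _ = _ := one_mul _

theorem radialRetraction_smul_of_one_le {e : X} (he : ‖e‖ = 1) {r : ℝ} (hr : 1 ≤ r) :
    radialRetraction ((r : ℂ) • e) = e := by
  have h0 : (r : ℂ) ≠ 0 := by exact_mod_cast (by linarith : r ≠ 0)
  have hn : ‖(r : ℂ) • e‖ = r := by
    rw [norm_smul, he, mul_one, Complex.norm_real, Real.norm_of_nonneg (by linarith)]
  rw [radialRetraction, hn, max_eq_right hr, smul_smul, Complex.ofReal_inv, inv_mul_cancel₀ h0,
    one_smul]

end RadialRetraction

/-! ### The equivalence in an abstract sequence space. -/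

section SequenceSpace

variable (X : Type*) [NormedAddCommGroup X] [NormedSpace ℂ X]

/-- The features common to `ℓ_p(ℤ)` and `c_0(ℤ)`: a space of complex sequences with a norm which
dominates the coordinates, normalized unit vectors, and bounded weighted translations. -/
structure SequenceSpace where
  coord : X →ₗ[ℂ] ℤ → ℂ
  coord_injective : Function.Injective coord
  norm_coord_le : ∀ x j, ‖coord x j‖ ≤ ‖x‖
  unit : ℤ → X
  coord_unit : ∀ j, coord (unit j) = Pi.single j 1
  norm_unit : ∀ j, ‖unit j‖ = 1
  exists_translation : ∀ (f : ℤ → ℂ) (C : ℝ) (m : ℤ), 0 ≤ C → (∀ j, ‖f j‖ ≤ C) →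
    ∃ D : X →L[ℂ] X, ‖D‖ ≤ C ∧ ∀ x j, coord (D x) j = f j * coord x (j + m)

variable {X} (E : SequenceSpace X) {w v U : ℤ → ℝ} {T : X ≃L[ℂ] X}

theorem SequenceSpace.apply_unit (hT : ∀ x, E.coord (T x) = bilateralShift w (E.coord x)) (k : ℤ) :
    T (E.unit k) = (w k : ℂ) • E.unit (k - 1) := by
  apply E.coord_injective
  funext n
  rw [hT, map_smul, Pi.smul_apply, E.coord_unit, E.coord_unit, bilateralShift, smul_eq_mul]
  by_cases h : n + 1 = k
  · subst h; simp
  · rw [Pi.single_eq_of_ne h, Pi.single_eq_of_ne (by omega), mul_zero, mul_zero]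

theorem SequenceSpace.sub_le_of_bounded_solution
    (hT : ∀ x, E.coord (T x) = bilateralShift w (E.coord x))
    (hv : ∀ j, 0 < v j) (hvw : ∀ j, v (j + 1) = w (j + 1) * v j) (hU : ∀ j, U j = U (j + 1) + v j)
    {κ : ℝ} (hκ : κ ≠ 0) (j : ℤ) (M : ℕ) {Y : ℕ → X} (hYb : ∀ m, ‖Y m‖ ≤ 1)
    (hY : ∀ m < M, Y (m + 1) = T (Y m) + (κ : ℂ) • E.unit (j - m - 1)) :
    U (j - M) - U j ≤ |κ|⁻¹ * (v (j - M) + v j) := by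
  -- Along the diagonal, the coordinate scaled by `v` changes at each step only by the forcing `κ *
  -- v (j-m-1)`.
  have hrec : ∀ m ≤ M, (v (j - m) : ℂ) * E.coord (Y m) (j - m) =
      v j * E.coord (Y 0) j + κ * ((U (j - m) - U j : ℝ) : ℂ) := by
    intro m
    induction m with
    | zero => simp
    | succ m ih =>
      intro hm
      have h1 := ih (by omega)
      have h2 := hvw (j - m - 1)
      have h3 := hU (j - m - 1)
      rw [sub_add_cancel] at h2 h3
      rw [Nat.cast_succ, ← sub_sub, hY m (by omega), map_add, Pi.add_apply, hT, map_smul,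
        Pi.smul_apply, E.coord_unit, Pi.single_eq_same, bilateralShift, sub_add_cancel, h3]
      rw [h2] at h1
      push_cast at h1 ⊢
      simp only [smul_eq_mul]
      linear_combination h1
  have h := hrec M le_rfl
  have hb : ∀ m : ℕ, ‖(v (j - m) : ℂ) * E.coord (Y m) (j - m)‖ ≤ v (j - m) := fun m => by
    rw [norm_mul, Complex.norm_real, Real.norm_of_nonneg (hv _).le]
    exact mul_le_of_le_one_right (hv _).le ((E.norm_coord_le _ _).trans (hYb m))
  have hM := hb M
  have h0 := hb 0
  rw [Nat.cast_zero, sub_zero] at h0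
  have hκU : ‖(κ : ℂ) * ((U (j - M) - U j : ℝ) : ℂ)‖ ≤ v (j - M) + v j := by
    rw [← sub_eq_of_eq_add' h]
    exact (norm_sub_le _ _).trans (add_le_add hM h0)
  rw [norm_mul, Complex.norm_real, Complex.norm_real, Real.norm_eq_abs, Real.norm_eq_abs] at hκU
  rw [inv_mul_eq_div, le_div_iff₀ (abs_pos.2 hκ), mul_comm]
  exact (mul_le_mul_of_nonneg_left (le_abs_self _) (abs_nonneg _)).trans hκU

theorem sub_le_of_forall_nat {K : ℝ} (hK : 0 ≤ K) (hv : ∀ j, 0 < v j)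
    (hU : ∀ j, U j = U (j + 1) + v j)
    (h : ∀ (j : ℤ) (M : ℕ), U (j - M) - U j ≤ K * (v (j - M) + v j)) (i j : ℤ) :
    U i - U j ≤ K * (v i + v j) := by
  rcases le_total i j with hij | hij
  · have := h j (j - i).toNat
    rwa [Int.toNat_of_nonneg (by omega), sub_sub_cancel] at this
  · have hanti : Antitone U := antitone_int_of_succ_le fun n => by
      have := hU n; have := hv n; linarith
    have h1 := hanti hij
    have : 0 ≤ K * (v i + v j) := mul_nonneg hK (add_pos (hv i) (hv j)).le
    linarith

theorem SequenceSpace.sub_le_of_hasShadowing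
    (hT : ∀ x, E.coord (T x) = bilateralShift w (E.coord x))
    (hv : ∀ j, 0 < v j) (hvw : ∀ j, v (j + 1) = w (j + 1) * v j) (hU : ∀ j, U j = U (j + 1) + v j)
    (h : HasShadowing T) : ∃ K > 0, ∀ i j, U i - U j ≤ K * (v i + v j) := by
  obtain ⟨δ, hδ, h⟩ := h 1 one_pos
  refine ⟨|δ|⁻¹, by positivity, sub_le_of_forall_nat (by positivity) hv hU fun j M => ?_⟩
  let z : ℕ → X := fun m => Nat.rec 0 (fun m x => T x + (δ : ℂ) • E.unit (j - m - 1)) m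
  have hz : ∀ m, z (m + 1) = T (z m) + (δ : ℂ) • E.unit (j - m - 1) := fun m => rfl
  -- `toNat` extends `z` by its value `z 0 = 0` to negative times.
  have hps : IsPseudotrajectory (T : X →L[ℂ] X) δ fun n => z n.toNat := by
    intro n
    simp only [ContinuousLinearEquiv.coe_coe]
    rcases le_or_gt 0 n with hn | hn
    · rw [show (n + 1).toNat = n.toNat + 1 by omega, hz, sub_add_cancel_left, norm_neg, norm_smul,
        E.norm_unit, mul_one, Complex.norm_real, Real.norm_of_nonneg hδ.le]
    · rw [show (n + 1).toNat = 0 by omega, show n.toNat = 0 by omega]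
      simp [z, hδ.le]
  obtain ⟨y, hy⟩ := h _ hps
  refine E.sub_le_of_bounded_solution hT hv hvw hU hδ.ne' j M
    (Y := fun m => z m - (T ^ (m : ℤ)) y) (fun m => ?_) fun m _ => ?_
  · rw [norm_sub_rev]
    exact (hy m).le
  · have : (T ^ ((m + 1 : ℕ) : ℤ)) y = T ((T ^ (m : ℤ)) y) := by
      rw [Nat.cast_succ, add_comm, zpow_one_add]; rfl
    rw [hz, this, map_sub]
    abel

/-- With `α = κ • radialRetraction ∘ T`, the perturbation is exactly `κ e_{j-m-1}` along an orbit of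
large positive multiples of unit vectors. The conjugacy equation then makes `φ` along this orbit a
bounded solution with forcing `-κ`. -/
theorem SequenceSpace.sub_le_of_stronglyStructurallyStable
    (hT : ∀ x, E.coord (T x) = bilateralShift w (E.coord x))
    (hv : ∀ j, 0 < v j) (hvw : ∀ j, v (j + 1) = w (j + 1) * v j) (hU : ∀ j, U j = U (j + 1) + v j)
    (h : StronglyStructurallyStable (T : X →L[ℂ] X)) :
    ∃ K > 0, ∀ i j, U i - U j ≤ K * (v i + v j) := by
  obtain ⟨δ, hδ, h⟩ := h 1 one_pos
  set N := ‖(T : X →L[ℂ] X)‖ with hN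
  have hN0 : 0 ≤ N := norm_nonneg _
  obtain ⟨κ, hκ, hκδ, hκN⟩ : ∃ κ > 0, κ ≤ δ ∧ κ * (2 * N) ≤ δ := by
    have hD : 0 < 2 * N + 1 := by positivity
    refine ⟨δ / (2 * N + 1), by positivity, ?_, ?_⟩
    · rw [div_le_iff₀ hD]; nlinarith
    · rw [div_mul_eq_mul_div, div_le_iff₀ hD]; nlinarith
  have hκn : ‖(κ : ℂ)‖ = κ := by rw [Complex.norm_real, Real.norm_of_nonneg hκ.le]
  obtain ⟨φ, hφ, -, hconj⟩ := h (fun x => (κ : ℂ) • radialRetraction (T x))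
    (fun x => by
      rw [norm_smul, hκn]
      exact (mul_le_of_le_one_right hκ.le (norm_radialRetraction_le _)).trans hκδ)
    (fun x y => by
      rw [← smul_sub, norm_smul, hκn]
      calc _ ≤ κ * (2 * (N * ‖x - y‖)) := by
            gcongr
            refine (norm_radialRetraction_sub_le _ _).trans ?_
            rw [← map_sub]
            gcongr
            exact (T : X →L[ℂ] X).le_opNorm _
        _ = κ * (2 * N) * ‖x - y‖ := by ring
        _ ≤ δ * ‖x - y‖ := by gcongr)
  refine ⟨|-κ|⁻¹, by rw [abs_neg]; positivity,
    sub_le_of_forall_nat (by positivity) hv hU fun j M => ?_⟩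
  -- `R` dominates every weight met, so each `T (x m)` with `m < M` has norm at least 1 and is
  -- retracted to a unit vector.
  set R := ∑ m ∈ Finset.range M, v (j - m - 1) with hR
  have hRv : ∀ m < M, v (j - m - 1) ≤ R := fun m hm =>
    Finset.single_le_sum (f := fun m : ℕ => v (j - m - 1)) (fun i _ => (hv _).le)
      (Finset.mem_range.2 hm)
  have hanti : Antitone U := antitone_int_of_succ_le fun n => by
    have := hU n; have := hv n; linarith
  let x : ℕ → X := fun m => (((R + κ * (U (j - m) - U j)) / v (j - m) : ℝ) : ℂ) • E.unit (j - m)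
  have hTx : ∀ m : ℕ, T (x m) =
      (((R + κ * (U (j - m) - U j)) / v (j - m - 1) : ℝ) : ℂ) • E.unit (j - m - 1) := fun m => by
    simp only [x]
    rw [map_smul, E.apply_unit hT, smul_smul, ← Complex.ofReal_mul]
    congr 2
    have h2 := hvw (j - m - 1)
    rw [sub_add_cancel] at h2
    have h3 := (hv (j - m - 1)).ne'
    have h4 := (hv (j - m)).ne'
    rw [div_mul_eq_mul_div, div_eq_div_iff h4 h3, h2]
    ring
  have hrT : ∀ m < M, radialRetraction (T (x m)) = E.unit (j - m - 1) := fun m hm => by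
    rw [hTx, radialRetraction_smul_of_one_le (E.norm_unit _)]
    rw [one_le_div (hv _)]
    have h1 := hRv m hm
    have h2 : U j ≤ U (j - m) := hanti (by omega)
    have := mul_nonneg hκ.le (sub_nonneg.2 h2)
    linarith
  have hx : ∀ m < M, T (x m) + (κ : ℂ) • radialRetraction (T (x m)) = x (m + 1) := fun m hm => by
    rw [hrT m hm, hTx, ← add_smul, ← Complex.ofReal_add]
    simp only [x]
    rw [Nat.cast_succ, ← sub_sub]
    congr 2
    have h3 := hU (j - m - 1)
    rw [sub_add_cancel] at h3
    have h4 := (hv (j - m - 1)).ne'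
    rw [h3]
    field_simp
    ring
  refine E.sub_le_of_bounded_solution hT hv hvw hU (neg_ne_zero.2 hκ.ne') j M
    (Y := fun m => φ (x m)) (fun m => hφ _) fun m hm => ?_
  have h1 := hconj (x m)
  rw [ContinuousLinearEquiv.coe_coe, hx m hm, ← hx m hm, hrT m hm, map_add] at h1
  rw [← hx m hm, hrT m hm, Complex.ofReal_neg, neg_smul]
  have := add_left_cancel (h1.trans (add_assoc _ _ _))
  rw [this]
  abel

theorem SequenceSpace.exists_isGreenKernel
    (hT : ∀ x, E.coord (T x) = bilateralShift w (E.coord x))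
    (hv : ∀ j, 0 < v j) (hvw : ∀ j, v (j + 1) = w (j + 1) * v j) (hU : ∀ j, U j = U (j + 1) + v j)
    {K : ℝ} (hK : 0 < K) (h : ∀ i j, U i - U j ≤ K * (v i + v j)) :
    ∃ Γ, IsGreenKernel (T : X →L[ℂ] X) Γ := by
  obtain ⟨a, ha⟩ := exists_sub_const_abs_le h
  set s : ℤ → ℝ := fun j => U j - a
  have hs : ∀ j, s j = s (j + 1) + v j := fun j => by
    simp only [s]; rw [hU j]; ring
  -- The coefficients of `P` for `n < 0` and of `-(I - P)` for `n ≥ 0`; their jump at `n = 0` is the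
  -- identity term of the recurrence.
  let σ : ℤ → ℤ → ℝ := fun n k =>
    if n < 0 then (if 0 ≤ s k + s (k + 1) then 1 else 0)
    else (if 0 ≤ s k + s (k + 1) then 0 else -1)
  let B : ℤ → ℝ := fun n => 2 * K * (K / (K + 1)) ^ (if n < 0 then -1 - n else n).toNat
  have hB0 : ∀ n, 0 ≤ B n := fun n => by positivity
  have hf : ∀ n j : ℤ, ‖((v (j + (-n - 1)) / v j * σ n (j + (-n - 1)) : ℝ) : ℂ)‖ ≤ B n := by
    intro n j
    rw [Complex.norm_real, norm_mul, norm_div, Real.norm_of_nonneg (hv _).le,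
      Real.norm_of_nonneg (hv _).le]
    simp only [σ, B]
    rcases lt_or_ge n 0 with hn | hn
    · simp only [hn, if_true]
      split_ifs with hA
      · rw [norm_one, mul_one, div_le_iff₀ (hv j)]
        have := weight_le_pow_mul_sub hK hs hv ha hA (-1 - n).toNat
        rwa [Int.toNat_of_nonneg (by omega),
          show j + (-n - 1) - (-1 - n) = j by ring] at this
      · rw [norm_zero, mul_zero]; positivity
    · simp only [hn.not_gt, if_false]
      split_ifs with hA
      · rw [norm_zero, mul_zero]; positivity
      · rw [norm_neg, norm_one, mul_one, div_le_iff₀ (hv j)]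
        have := weight_le_pow_mul_add hK hs ha (not_le.1 hA) n.toNat
        rwa [Int.toNat_of_nonneg hn, show j + (-n - 1) + 1 + n = j by ring] at this
  choose Γ hΓn hΓ using fun n : ℤ => E.exists_translation
    (fun j => ((v (j + (-n - 1)) / v j * σ n (j + (-n - 1)) : ℝ) : ℂ)) (B n) (-n - 1) (hB0 n) (hf n)
  refine ⟨Γ, Summable.of_nonneg_of_le (fun _ => norm_nonneg _) hΓn ?_, fun n x => ?_⟩
  · have hgeo : Summable fun m : ℕ => 2 * K * (K / (K + 1)) ^ m :=
      (summable_geometric_of_lt_one (by positivity)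
        ((div_lt_one (by positivity)).2 (by linarith))).mul_left _
    refine Summable.of_nat_of_neg_add_one (hgeo.congr fun m => ?_) (hgeo.congr fun m => ?_)
    · simp only [B]
      rw [if_neg (by omega), Int.toNat_natCast]
    · simp only [B]
      rw [if_pos (by omega)]
      congr 2
      omega
  · apply E.coord_injective
    funext j
    have hj : (v j : ℂ) ≠ 0 := by exact_mod_cast (hv j).ne'
    have hj1 := (hv (j + 1)).ne'
    have hcoef : v (j + 1) / v j * (v (j - n) / v (j + 1) * σ n (j - n)) =
        v (j - n) / v j * σ n (j - n) := by
      field_simp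
    have hw' : w (j + 1) = v (j + 1) / v j := by
      rw [hvw, mul_div_cancel_right₀ _ (hv j).ne']
    rw [map_add, Pi.add_apply, ContinuousLinearEquiv.coe_coe, hT, bilateralShift, hΓ, hΓ,
      show j + (-(n - 1) - 1) = j - n by ring, show j + 1 + (-n - 1) = j - n by ring,
      ← mul_assoc, ← Complex.ofReal_mul, hw', hcoef]
    by_cases hn : n = 0
    · subst hn
      simp only [σ, sub_zero, zero_sub, if_true, lt_irrefl, if_false, neg_lt_zero, one_pos]
      split_ifs <;> push_cast <;> field_simp <;> ring
    · have hσ : σ (n - 1) (j - n) = σ n (j - n) := by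
        simp only [σ, show n - 1 < 0 ↔ n < 0 by omega]
      rw [hσ, if_neg hn, map_zero, Pi.zero_apply, add_zero]

theorem SequenceSpace.stronglyStructurallyStable_iff_hasShadowing [CompleteSpace X]
    (hw : ∀ n, 0 < w n) (hT : ∀ x, E.coord (T x) = bilateralShift w (E.coord x)) :
    StronglyStructurallyStable (T : X →L[ℂ] X) ↔ HasShadowing T := by
  obtain ⟨v, hv, hvw⟩ := exists_pos_forall_succ_eq_mul hw
  obtain ⟨U, hU⟩ := exists_forall_succ_eq_add fun n => -v n
  have hU' : ∀ j, U j = U (j + 1) + v j := fun j => by rw [hU]; ring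
  constructor
  · intro h
    obtain ⟨K, hK, h⟩ := E.sub_le_of_stronglyStructurallyStable hT hv hvw hU' h
    obtain ⟨Γ, hΓ⟩ := E.exists_isGreenKernel hT hv hvw hU' hK h
    exact hΓ.hasShadowing
  · intro h
    obtain ⟨K, hK, h⟩ := E.sub_le_of_hasShadowing hT hv hvw hU' h
    obtain ⟨Γ, hΓ⟩ := E.exists_isGreenKernel hT hv hvw hU' hK h
    exact hΓ.stronglyStructurallyStable

end SequenceSpace

/-! ### The spaces `ℓ_p(ℤ)` and `c_0(ℤ)`. -/

section Instances

theorem memℓp_mul_translate {p : ℝ≥0∞} (hp : 0 < p.toReal) {f : ℤ → ℂ} {C : ℝ}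
    (hf : ∀ j, ‖f j‖ ≤ C) (m : ℤ) (x : lp (fun _ : ℤ => ℂ) p) :
    Memℓp (fun j => f j * x (j + m)) p ∧
      ∑' j, ‖f j * x (j + m)‖ ^ p.toReal ≤ (C * ‖x‖) ^ p.toReal := by
  have hC : 0 ≤ C := (norm_nonneg _).trans (hf 0)
  have hx := (lp.memℓp x).summable hp
  have hxm : Summable fun j => C ^ p.toReal * ‖x (j + m)‖ ^ p.toReal :=
    ((Equiv.addRight m).summable_iff.2 hx).mul_left _
  have hle : ∀ j, ‖f j * x (j + m)‖ ^ p.toReal ≤ C ^ p.toReal * ‖x (j + m)‖ ^ p.toReal :=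
    fun j => by
      rw [← Real.mul_rpow hC (norm_nonneg _), norm_mul]
      gcongr
      exact hf j
  have hs : Summable fun j => ‖f j * x (j + m)‖ ^ p.toReal :=
    Summable.of_nonneg_of_le (fun j => by positivity) hle hxm
  refine ⟨memℓp_gen hs, (hs.tsum_le_tsum hle hxm).trans (le_of_eq ?_)⟩
  rw [tsum_mul_left, Real.mul_rpow hC (lp.norm_nonneg' x), lp.norm_rpow_eq_tsum hp,
    ← (Equiv.addRight m).tsum_eq fun j => ‖x j‖ ^ p.toReal]
  rfl

/-- `ℓ_p(ℤ)` as a sequence space. -/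
noncomputable def lpSequenceSpace (p : ℝ≥0∞) [Fact (1 ≤ p)] (hp : p ≠ ∞) :
    SequenceSpace (lp (fun _ : ℤ => ℂ) p) where
  coord := { toFun := fun x => x, map_add' := fun _ _ => rfl, map_smul' := fun _ _ => rfl }
  coord_injective := fun _ _ h => lp.ext h
  norm_coord_le := fun x j => lp.norm_apply_le_norm (zero_lt_one.trans_le Fact.out).ne' x j
  unit := fun j => lp.single p j 1
  coord_unit := fun j => lp.coeFn_single p j 1
  norm_unit := fun j => by
    rw [lp.norm_single (zero_lt_one.trans_le Fact.out), norm_one]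
  exists_translation := fun f C m hC hf => by
    have hp0 : 0 < p.toReal := ENNReal.toReal_pos (zero_lt_one.trans_le Fact.out).ne' hp
    let D : lp (fun _ : ℤ => ℂ) p →ₗ[ℂ] lp (fun _ : ℤ => ℂ) p :=
      { toFun := fun x => ⟨fun j => f j * x (j + m), (memℓp_mul_translate hp0 hf m x).1⟩
        map_add' := fun x y => by
          ext j
          exact mul_add _ _ _
        map_smul' := fun c x => by
          ext j
          exact mul_left_comm _ _ _ }
    refine ⟨D.mkContinuous C fun x => ?_, D.mkContinuous_norm_le hC _, fun _ _ => rfl⟩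
    exact lp.norm_le_of_tsum_le hp0 (by positivity) (memℓp_mul_translate hp0 hf m x).2

theorem ZeroAtInftyContinuousMap.norm_apply_le (x : ZeroAtInftyContinuousMap ℤ ℂ) (j : ℤ) :
    ‖x j‖ ≤ ‖x‖ := by
  rw [← ZeroAtInftyContinuousMap.norm_toBCF_eq_norm]
  exact x.toBCF.norm_coe_le_norm j

theorem ZeroAtInftyContinuousMap.norm_le_of_forall {x : ZeroAtInftyContinuousMap ℤ ℂ} {C : ℝ}
    (hC : 0 ≤ C) (h : ∀ j, ‖x j‖ ≤ C) : ‖x‖ ≤ C := by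
  rw [← ZeroAtInftyContinuousMap.norm_toBCF_eq_norm]
  exact (BoundedContinuousFunction.norm_le hC).2 h

/-- The unit vectors of `c_0(ℤ)`. -/
noncomputable def zeroAtInftySingle (j : ℤ) : ZeroAtInftyContinuousMap ℤ ℂ where
  toFun := Pi.single j 1
  continuous_toFun := continuous_of_discreteTopology
  zero_at_infty' := by
    rw [Filter.cocompact_eq_cofinite]
    refine tendsto_const_nhds.congr' ?_
    filter_upwards [(Set.finite_singleton j).compl_mem_cofinite] with k hk
    rw [Pi.single_eq_of_ne hk]

/-- `c_0(ℤ)` as a sequence space. -/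
noncomputable def zeroAtInftySequenceSpace : SequenceSpace (ZeroAtInftyContinuousMap ℤ ℂ) where
  coord := { toFun := fun x => x, map_add' := fun _ _ => rfl, map_smul' := fun _ _ => rfl }
  coord_injective := DFunLike.coe_injective
  norm_coord_le := ZeroAtInftyContinuousMap.norm_apply_le
  unit := zeroAtInftySingle
  coord_unit := fun _ => rfl
  norm_unit := fun j => by
    have h1 : zeroAtInftySingle j j = 1 :=
      Pi.single_eq_same (M := fun _ : ℤ => ℂ) j 1
    refine le_antisymm (ZeroAtInftyContinuousMap.norm_le_of_forall zero_le_one fun k => ?_) ?_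
    · by_cases h : k = j
      · rw [h, h1, norm_one]
      · have : zeroAtInftySingle j k = 0 :=
          Pi.single_eq_of_ne (M := fun _ : ℤ => ℂ) h 1
        rw [this, norm_zero]
        exact zero_le_one
    · simpa [h1] using ZeroAtInftyContinuousMap.norm_apply_le (zeroAtInftySingle j) j
  exists_translation := fun f C m hC hf => by
    let D : ZeroAtInftyContinuousMap ℤ ℂ →ₗ[ℂ] ZeroAtInftyContinuousMap ℤ ℂ :=
      { toFun := fun x =>
          { toFun := fun j => f j * x (j + m)
            continuous_toFun := continuous_of_discreteTopology
            zero_at_infty' := by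
              have hx : Filter.Tendsto (fun j => x (j + m)) (Filter.cocompact ℤ) (nhds 0) := by
                refine x.zero_at_infty'.comp ?_
                rw [Filter.cocompact_eq_cofinite]
                exact (add_left_injective m).tendsto_cofinite
              refine squeeze_zero_norm (fun j => ?_) (by simpa using hx.norm.const_mul C)
              rw [norm_mul]
              gcongr
              exact hf j }
        map_add' := fun x y => by
          ext j
          exact mul_add _ _ _
        map_smul' := fun c x => by
          ext j
          exact mul_left_comm _ _ _ }
    refine ⟨D.mkContinuous C fun x => ?_, D.mkContinuous_norm_le hC _, fun _ _ => rfl⟩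
    refine ZeroAtInftyContinuousMap.norm_le_of_forall (by positivity) fun j => ?_
    refine (norm_mul_le _ _).trans ?_
    gcongr
    · exact hf j
    · exact x.norm_apply_le _

end Instances

theorem mainTheorem2 (w : ℤ → ℝ) (hw : ∀ n, 0 < w n) :
    (∀ (p : ℝ≥0∞) [Fact (1 ≤ p)], p ≠ ∞ →
      ∀ T : lp (fun _ : ℤ => ℂ) p ≃L[ℂ] lp (fun _ : ℤ => ℂ) p,
        (∀ x : lp (fun _ : ℤ => ℂ) p, (T x : ℤ → ℂ) = bilateralShift w (x : ℤ → ℂ)) →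
          (StronglyStructurallyStable
              (T : lp (fun _ : ℤ => ℂ) p →L[ℂ] lp (fun _ : ℤ => ℂ) p) ↔
            HasShadowing T)) ∧
    (∀ T : ZeroAtInftyContinuousMap ℤ ℂ ≃L[ℂ] ZeroAtInftyContinuousMap ℤ ℂ,
        (∀ x : ZeroAtInftyContinuousMap ℤ ℂ, (T x : ℤ → ℂ) = bilateralShift w (x : ℤ → ℂ)) →
          (StronglyStructurallyStable
              (T : ZeroAtInftyContinuousMap ℤ ℂ →L[ℂ] ZeroAtInftyContinuousMap ℤ ℂ) ↔
            HasShadowing T)) :=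
  ⟨fun p _ hp _ hT =>
      (lpSequenceSpace p hp).stronglyStructurallyStable_iff_hasShadowing hw hT,
    fun _ hT => zeroAtInftySequenceSpace.stronglyStructurallyStable_iff_hasShadowing hw hT⟩
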